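/- Let $n,k,t\ge 1$ be integers such that $t$ divides $2nk$, let $v=2nk+t$, and let $J$ be the subgroup of $\mathbb{Z}_v=\mathbb{Z}/v\mathbb{Z}$ of order $t$. A square integer relative Heffter array $IH_t(n;k)$ is an $n\times n$ array, some of whose cells may be empty, with entries in $\mathbb{Z}_v$, such that 1. each row and each column contains exactly $k$ filled cells; 2. for every $x\in\mathbb{Z}_v\setminus J$, either $x$ or $-x$ appears in the array; 3. when each entry is written as the integer of absolute value at most $v/2$ that represents it (with $v/2$ chosen for its class if $v$ is even), the entries in every row and in every column sum to $0$ in $\mathbb{Z}$. (If $t$ does not divide $2nk$, there is by definition no $IH_t(n;k)$.) Theorem. Let $n\ge 3$ be a prime and let $t$ be a positive integer. - If $n\equiv 1\pmod 4$, then an $IH_t(n;3)$ exists if and only if $t\in\{1,2,n,2n\}$. - If $n\equiv 3\pmod 4$, then an $IH_t(n;3)$ exists if and only if $t\in\{3,6,n,2n\}$. -/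

import Mathlib

/-- A partially filled `m × n` array with entries in `ℤ/v`; `none` is an empty cell. -/
abbrev PartialArray (m n v : ℕ) : Type := Fin m → Fin n → Option (ZMod v)

/-- The integer in the symmetric residue system `{0, ±1, ±2, …}`, of absolute value at most `v / 2`,
that represents the entry of a cell; an empty cell contributes `0` to a sum. -/
def cellInt {v : ℕ} (c : Option (ZMod v)) : ℤ := c.elim 0 ZMod.valMinAbs

/-- `A` is a Heffter array `H_t(m,n;h,k)` over `ℤ/v`, `v = 2nk + t`, relative to the
subgroup `J` of order `t`. -/
structure IsRelativeHeffterArray (t m n h k : ℕ) (J : AddSubgroup (ZMod (2 * n * k + t)))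
    (A : PartialArray m n (2 * n * k + t)) : Prop where
  modulus_pos : 0 < 2 * n * k + t
  order_dvd : t ∣ 2 * n * k
  card_subgroup : Nat.card J = t
  row_filled : ∀ i : Fin m, (Finset.univ.filter fun j : Fin n => (A i j).isSome).card = h
  col_filled : ∀ j : Fin n, (Finset.univ.filter fun i : Fin m => (A i j).isSome).card = k
  covers : ∀ x : ZMod (2 * n * k + t), x ∉ J →
    (∃ i j, A i j = some x) ∨ (∃ i j, A i j = some (-x))
  row_sum : ∀ i : Fin m, ∑ j : Fin n, (A i j).getD 0 = 0
  col_sum : ∀ j : Fin n, ∑ i : Fin m, (A i j).getD 0 = 0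

/-- An integer relative Heffter array `IH_t(m,n;h,k)`: the rows and columns sum to zero already
in `ℤ`, the entries being read as integers of absolute value at most `v / 2`. -/
structure IsIntegerRelativeHeffterArray (t m n h k : ℕ)
    (J : AddSubgroup (ZMod (2 * n * k + t))) (A : PartialArray m n (2 * n * k + t)) : Prop
    extends IsRelativeHeffterArray t m n h k J A where
  row_sum_int : ∀ i : Fin m, ∑ j : Fin n, cellInt (A i j) = 0
  col_sum_int : ∀ j : Fin n, ∑ i : Fin m, cellInt (A i j) = 0

/-- There exists a square integer relative Heffter array `IH_t(n;k)`. -/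
def ExistsIH (t n k : ℕ) : Prop :=
  ∃ (J : AddSubgroup (ZMod (2 * n * k + t))) (A : PartialArray n n (2 * n * k + t)),
    IsIntegerRelativeHeffterArray t n n k k J A

/-!
Let `v = 6n + t`. As `t ∣ 6n`, a class modulo `v` lies outside `J` exactly when its representatives
are not divisible by `g = v / t`, and there are `6n` such classes, none of them its own negative.
The `3n` filled cells therefore contain, up to sign, each integer in `[1, v / 2]` not divisible by
`g` exactly once, and all entries add up to `0`, so the sum of these integers is even
(`ExistsIH.even_sum`). For `n` prime the divisors of `6n` are `1, 2, 3, 6, n, 2n, 3n, 6n`, and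
parity excludes `3n` and `6n` always, `1` and `2` when `n ≡ 3 (mod 4)`, and `3` and `6` when
`n ≡ 1 (mod 4)`.

The remaining cases are constructions on three cyclically adjacent diagonals. If `x` is a cyclic
sequence of length `n` and the off-diagonal entries are `x i + d / 2` and `x i - d / 2`, the line
sums vanish with diagonal entries `-(x i + x (i - 1))`. Only coverage has to be achieved
(`existsIH_of_seq`):

* For `t = n` and `t = 2n`, with `n = 2m + 1`, the sequence `w = (-m, 1, -m + 1, 2, …, m, 0)` is a
  permutation of `[-m, m]` whose cyclically consecutive sums are again a permutation of `[-m, m]`.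
  The affine images `x = 7w + 1` and `x = 8w + 3/2` make the three diagonals represent the three
  pairs of nonzero classes modulo `7`, respectively the classes modulo `8` not divisible by `4`.
* For `t = 3` and `t = 6`, with `n = 4m + 3`, take the zigzag `n, -1, n - 1, -2, …` of graceful
  labellings and reverse all signs in its second half. The consecutive differences of the zigzag,
  `n - 1, n - 2, …`, lose one value at the change of sign, which produces `n` instead, and the lost
  value comes back as the sum of the two ends. So both the labels and the cyclically consecutive
  sums have absolute values `1, …, n`. With `c = d / 2` the off-diagonals are, up to sign, `c ± x`;
  the value `c` itself is skipped, and `c = 2n + 1`, `c = 2n + 2` leave exactly the required gaps.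
* For `t = 1` and `t = 2`, with `n = 4m + 1`, the same zigzag on `1/2, 3/2, …, n - 1/2` with
  `d / 2 = 2n + 1/2` leaves no gap.
-/

/-! ### Tridiagonal arrays -/

/-- The integer array supported on three cyclically adjacent diagonals, with `u i` in cell
`(i, i + 1)`, `u i - d` in cell `(i + 1, i)` and the entry forced by the line sums in cell
`(i, i)`, reduced modulo `v`. -/
def tridiagonal {n : ℕ} [NeZero n] (v : ℕ) (u : Fin n → ℤ) (d : ℤ) : PartialArray n n v :=
  fun i j =>
    if j = i then some ((d - u i - u (i - 1) : ℤ) : ZMod v)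
    else if j = i + 1 then some ((u i : ℤ) : ZMod v)
    else if j = i - 1 then some ((u j - d : ℤ) : ZMod v)
    else none

lemma cellInt_some_intCast {v : ℕ} [NeZero v] {z : ℤ} (hz : 2 * |z| < v) :
    cellInt (some (z : ZMod v)) = z := by
  have := abs_lt.1 (show |2 * z| < v by rw [abs_mul]; simpa using hz)
  refine (ZMod.valMinAbs_spec _ _).2 ⟨rfl, ?_, ?_⟩ <;> omega

lemma getD_eq_intCast_cellInt {v : ℕ} (c : Option (ZMod v)) :
    c.getD 0 = ((cellInt c : ℤ) : ZMod v) := by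
  cases c <;> simp [cellInt]

lemma Fin.ne_add_one {n : ℕ} [NeZero n] (hn : 3 ≤ n) (i : Fin n) : i ≠ i + 1 := by
  have : (1 : Fin n) ≠ 0 := by
    rw [Ne, Fin.ext_iff, Fin.val_one', Fin.val_zero, Nat.mod_eq_of_lt (by omega)]
    omega
  simpa using this

lemma Fin.add_one_ne_sub_one {n : ℕ} [NeZero n] (hn : 3 ≤ n) (i : Fin n) : i + 1 ≠ i - 1 := by
  have : (1 : Fin n) + 1 ≠ 0 := by
    rw [Ne, Fin.ext_iff, Fin.val_add, Fin.val_one', Fin.val_zero,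
      Nat.mod_eq_of_lt (a := 1) (by omega), Nat.mod_eq_of_lt (by omega)]
    omega
  intro h
  apply this
  have h2 : i + (1 + 1) = i := by rw [← add_assoc, h, sub_add_cancel]
  simpa using h2

section Tridiagonal

variable {n v : ℕ} [NeZero n] {u : Fin n → ℤ} {d : ℤ}

lemma cellInt_tridiagonal [NeZero v] (hn : 3 ≤ n) (hu : ∀ i, 2 * |u i| < v)
    (hu' : ∀ i, 2 * |u i - d| < v) (hd : ∀ i, 2 * |d - u i - u (i - 1)| < v) (i j : Fin n) :
    cellInt (tridiagonal v u d i j) = (if j = i then d - u i - u (i - 1) else 0) +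
      (if j = i + 1 then u i else 0) + if j = i - 1 then u (i - 1) - d else 0 := by
  have h1 := Fin.ne_add_one hn i
  have h2 := Fin.add_one_ne_sub_one hn i
  have h3 : i ≠ i - 1 := by simpa using Fin.ne_add_one hn (i - 1) |>.symm
  unfold tridiagonal
  by_cases e1 : j = i
  · subst e1
    rw [if_pos rfl, cellInt_some_intCast (hd j)]
    simp [h1, h3]
  by_cases e2 : j = i + 1
  · subst e2
    rw [if_neg e1, if_pos rfl, cellInt_some_intCast (hu _)]
    simp [h2, e1]
  by_cases e3 : j = i - 1
  · subst e3
    rw [if_neg e1, if_neg e2, if_pos rfl, cellInt_some_intCast (hu' _)]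
    simp [e1, e2]
  · simp [e1, e2, e3, cellInt]

lemma isSome_tridiagonal (i j : Fin n) :
    (tridiagonal v u d i j).isSome ↔ j = i ∨ j = i + 1 ∨ j = i - 1 := by
  unfold tridiagonal
  split_ifs <;> simp_all

lemma sum_row_tridiagonal [NeZero v] (hn : 3 ≤ n) (hu : ∀ i, 2 * |u i| < v)
    (hu' : ∀ i, 2 * |u i - d| < v) (hd : ∀ i, 2 * |d - u i - u (i - 1)| < v) (i : Fin n) :
    ∑ j, cellInt (tridiagonal v u d i j) = 0 := by
  simp only [cellInt_tridiagonal hn hu hu' hd, Finset.sum_add_distrib, Finset.sum_ite_eq',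
    Finset.mem_univ, if_true]
  ring

lemma sum_col_tridiagonal [NeZero v] (hn : 3 ≤ n) (hu : ∀ i, 2 * |u i| < v)
    (hu' : ∀ i, 2 * |u i - d| < v) (hd : ∀ i, 2 * |d - u i - u (i - 1)| < v) (j : Fin n) :
    ∑ i, cellInt (tridiagonal v u d i j) = 0 := by
  have e1 : ∀ i : Fin n, j = i + 1 ↔ j - 1 = i := fun i => sub_eq_iff_eq_add.symm
  have e2 : ∀ i : Fin n, j = i - 1 ↔ j + 1 = i := fun i => eq_sub_iff_add_eq
  simp only [cellInt_tridiagonal hn hu hu' hd, Finset.sum_add_distrib, e1, e2, Finset.sum_ite_eq,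
    Finset.mem_univ, if_true, add_sub_cancel_right]
  ring

end Tridiagonal

/-- Reduction of existence to arithmetic: the line sums of a tridiagonal array vanish for every
choice of `u` and `d`, so it suffices that the entries are small and that their absolute values
exhaust the integers up to half the modulus that lie outside the subgroup of order `t`. -/
lemma existsIH_of_fin {n t : ℕ} [NeZero n] (hn : 3 ≤ n) (ht : t ∣ 6 * n) (u : Fin n → ℤ) (d : ℤ)
    (hu : ∀ i, 2 * |u i| < 6 * n + t) (hu' : ∀ i, 2 * |u i - d| < 6 * n + t)
    (hd : ∀ i, 2 * |d - u i - u (i - 1)| < 6 * n + t)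
    (hcov : ∀ s : ℕ, 2 * s ≤ 6 * n + t → ¬ 6 * n + t ∣ t * s →
      ∃ i, |u i| = s ∨ |u i - d| = s ∨ |d - u i - u (i - 1)| = s) :
    ExistsIH t n 3 := by
  have ht0 : 0 < t := Nat.pos_of_dvd_of_pos ht (by omega)
  obtain ⟨g, hg⟩ := ht
  have hv : 2 * n * 3 + t = (g + 1) * t := by rw [add_mul, one_mul, mul_comm g, ← hg]; ring
  have hv' : (6 * n + t : ℤ) = (2 * n * 3 + t : ℕ) := by push_cast; ring
  have : NeZero (2 * n * 3 + t) := ⟨by omega⟩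
  rw [hv'] at hu hu' hd
  refine ⟨AddSubgroup.zmultiples ((g + 1 : ℕ) : ZMod (2 * n * 3 + t)),
    tridiagonal _ u d, ⟨⟨by omega, ⟨g, by rw [← hg]; ring⟩, ?_, ?_, ?_, ?_, ?_, ?_⟩,
      sum_row_tridiagonal hn hu hu' hd, sum_col_tridiagonal hn hu hu' hd⟩⟩
  · rw [Nat.card_zmultiples, ZMod.addOrderOf_coe _ (by omega), hv,
      Nat.gcd_eq_right (Dvd.intro _ rfl), Nat.mul_div_cancel_left _ (by omega)]
  · intro i
    have : (Finset.univ.filter fun j => (tridiagonal (2 * n * 3 + t) u d i j).isSome) =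
        {i, i + 1, i - 1} := by
      ext j; simp [isSome_tridiagonal]
    have h3 : i ≠ i - 1 := by simpa using Fin.ne_add_one hn (i - 1) |>.symm
    rw [this, Finset.card_eq_three]
    exact ⟨_, _, _, Fin.ne_add_one hn i, h3, Fin.add_one_ne_sub_one hn i, rfl⟩
  · intro j
    have : (Finset.univ.filter fun i => (tridiagonal (2 * n * 3 + t) u d i j).isSome) =
        {j, j + 1, j - 1} := by
      ext i
      simp only [isSome_tridiagonal, Finset.mem_filter, Finset.mem_univ, true_and,
        Finset.mem_insert, Finset.mem_singleton, eq_sub_iff_add_eq]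
      grind
    have h3 : j ≠ j - 1 := by simpa using Fin.ne_add_one hn (j - 1) |>.symm
    rw [this, Finset.card_eq_three]
    exact ⟨_, _, _, Fin.ne_add_one hn j, h3, Fin.add_one_ne_sub_one hn j, rfl⟩
  · intro x hx
    have hle := ZMod.natAbs_valMinAbs_le x
    have key : ∀ z : ℤ, |z| = x.valMinAbs.natAbs →
        x = (z : ZMod (2 * n * 3 + t)) ∨ -x = (z : ZMod (2 * n * 3 + t)) := by
      intro z hz
      have hx' := x.coe_valMinAbs
      rw [Int.natCast_natAbs, abs_eq_abs] at hz
      rcases hz with h | h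
      · exact .inl (by rw [h, hx'])
      · exact .inr (by rw [h, Int.cast_neg, hx'])
    have wrap : ∀ z : ℤ, |z| = x.valMinAbs.natAbs →
        (∃ i j, tridiagonal (2 * n * 3 + t) u d i j = some (z : ZMod (2 * n * 3 + t))) →
        (∃ i j, tridiagonal (2 * n * 3 + t) u d i j = some x) ∨
        ∃ i j, tridiagonal (2 * n * 3 + t) u d i j = some (-x) := by
      intro z hz h
      rcases key z hz with e | e
      · exact .inl (e ▸ h)
      · exact .inr (e ▸ h)
    obtain ⟨i, h | h | h⟩ := hcov x.valMinAbs.natAbs (by omega) (by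
      intro h
      apply hx
      rw [show 6 * n + t = t * (g + 1) by rw [hg]; ring] at h
      obtain ⟨k, hk⟩ := Int.natCast_dvd.2 (Nat.dvd_of_mul_dvd_mul_left ht0 h)
      rw [AddSubgroup.mem_zmultiples_iff]
      refine ⟨k, ?_⟩
      rw [← x.coe_valMinAbs, hk]
      push_cast
      rw [zsmul_eq_mul]; ring)
    · refine wrap _ h ⟨i, i + 1, ?_⟩
      simp [tridiagonal, (Fin.ne_add_one hn i).symm]
    · refine wrap _ h ⟨i + 1, i, ?_⟩
      have h1 := Fin.add_one_ne_sub_one hn (i + 1)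
      rw [add_sub_cancel_right] at h1
      simp [tridiagonal, Fin.ne_add_one hn i, h1.symm]
    · exact wrap _ h ⟨i, i, by simp [tridiagonal]⟩
  · intro i
    simp only [getD_eq_intCast_cellInt, ← Int.cast_sum]
    rw [sum_row_tridiagonal hn hu hu' hd, Int.cast_zero]
  · intro j
    simp only [getD_eq_intCast_cellInt, ← Int.cast_sum]
    rw [sum_col_tridiagonal hn hu hu' hd, Int.cast_zero]

/-- The form of `existsIH_of_fin` with the sequence indexed by `0, …, n - 1` and the cyclic
neighbours `0` and `n - 1` treated separately. -/
lemma existsIH_of_seq {n t : ℕ} (hn : 3 ≤ n) (ht : t ∣ 6 * n) (u : ℕ → ℤ) (d : ℤ)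
    (hu : ∀ i < n, 2 * |u i| < 6 * n + t) (hu' : ∀ i < n, 2 * |u i - d| < 6 * n + t)
    (hd : ∀ i, i + 1 < n → 2 * |u i + u (i + 1) - d| < 6 * n + t)
    (hd' : 2 * |u 0 + u (n - 1) - d| < 6 * n + t)
    (hcov : ∀ s : ℕ, 2 * s ≤ 6 * n + t → ¬ 6 * n + t ∣ t * s →
      (∃ i < n, |u i| = s) ∨ (∃ i < n, |u i - d| = s) ∨
      (∃ i, i + 1 < n ∧ |u i + u (i + 1) - d| = s) ∨ |u 0 + u (n - 1) - d| = s) :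
    ExistsIH t n 3 := by
  have : NeZero n := ⟨by omega⟩
  have hsucc : ∀ i (hi : i + 1 < n), (⟨i + 1, hi⟩ : Fin n) - 1 = ⟨i, by omega⟩ := by
    intro i hi
    rw [sub_eq_iff_eq_add, Fin.ext_iff, Fin.val_add, Fin.val_one',
      Nat.mod_eq_of_lt (a := 1) (by omega), Nat.mod_eq_of_lt (by simpa using hi)]
  have hzero : (⟨0, by omega⟩ : Fin n) - 1 = ⟨n - 1, by omega⟩ := by
    rw [sub_eq_iff_eq_add, Fin.ext_iff, Fin.val_add, Fin.val_one',
      Nat.mod_eq_of_lt (a := 1) (by omega)]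
    simp [show n - 1 + 1 = n by omega]
  have hsucc' : ∀ i (hi : i + 1 < n),
      |d - u (⟨i + 1, hi⟩ : Fin n) - u ((⟨i + 1, hi⟩ : Fin n) - 1 : Fin n)| =
        |u i + u (i + 1) - d| := by
    intro i hi
    rw [hsucc, ← abs_neg]
    congr 1; ring
  have hzero' : |d - u (⟨0, by omega⟩ : Fin n) - u ((⟨0, by omega⟩ : Fin n) - 1 : Fin n)| =
      |u 0 + u (n - 1) - d| := by
    rw [hzero, ← abs_neg]
    congr 1; ring
  refine existsIH_of_fin hn ht (fun i => u i) d (fun i => hu i i.2) (fun i => hu' i i.2) ?_ ?_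
  · rintro ⟨_ | i, hi⟩
    · simpa only [hzero'] using hd'
    · simpa only [hsucc'] using hd i hi
  · intro s hs hs'
    rcases hcov s hs hs' with ⟨i, hi, h⟩ | ⟨i, hi, h⟩ | ⟨i, hi, h⟩ | h
    · exact ⟨⟨i, hi⟩, .inl h⟩
    · exact ⟨⟨i, hi⟩, .inr (.inl h)⟩
    · exact ⟨⟨i + 1, hi⟩, .inr (.inr ((hsucc' i hi).trans h))⟩
    · exact ⟨⟨0, by omega⟩, .inr (.inr (hzero'.trans h))⟩

/-! ### Two interleaved progressions: `t = n` and `t = 2n` -/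

/-- The sequence `-m, 1, -m + 1, 2, …, -1, m, 0`. -/
def interleave (m i : ℕ) : ℤ := if i % 2 = 0 then (i / 2 : ℕ) - m else ((i + 1) / 2 : ℕ)

lemma interleave_mem (m i : ℕ) (hi : i < 2 * m + 1) :
    -m ≤ interleave m i ∧ interleave m i ≤ m := by
  unfold interleave; split_ifs <;> omega

lemma interleave_add_succ (m i : ℕ) : interleave m i + interleave m (i + 1) = i + 1 - m := by
  unfold interleave; split_ifs <;> omega

lemma interleave_zero_add_last (m : ℕ) : interleave m 0 + interleave m (2 * m) = -m := by
  unfold interleave; split_ifs <;> omega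

lemma exists_interleave_eq (m : ℕ) (w : ℤ) (h : -m ≤ w) (h' : w ≤ m) :
    ∃ i < 2 * m + 1, interleave m i = w := by
  rcases le_or_gt w 0 with hw | hw
  · exact ⟨(2 * (w + m)).toNat, by omega, by unfold interleave; split_ifs <;> omega⟩
  · exact ⟨(2 * w - 1).toNat, by omega, by unfold interleave; split_ifs <;> omega⟩

/-- Let `n = 2m + 1`. If every nonmultiple of `(6n + t) / t` that is small enough is, up to sign, a
value on `[-m, m]` of one of three affine functions with slope `a`, then these values can be
arranged in an array, because the cyclically consecutive sums of `interleave m` run through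
`[-m, m]` as its values do. -/
lemma existsIH_of_affine {m t : ℕ} (hm : 1 ≤ m) (ht : t ∣ 6 * (2 * m + 1)) (a b d : ℤ)
    (hb : ∀ w : ℤ, -m ≤ w → w ≤ m → 2 * |a * w + b| < 6 * (2 * m + 1) + t ∧
      2 * |a * w + b - d| < 6 * (2 * m + 1) + t ∧
      2 * |a * w + 2 * b - d| < 6 * (2 * m + 1) + t)
    (hcov : ∀ s : ℕ, 2 * s ≤ 6 * (2 * m + 1) + t → ¬ 6 * (2 * m + 1) + t ∣ t * s →
      ∃ w : ℤ, (-m ≤ w ∧ w ≤ m) ∧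
        (|a * w + b| = s ∨ |a * w + b - d| = s ∨ |a * w + 2 * b - d| = s)) :
    ExistsIH t (2 * m + 1) 3 := by
  have hsum : ∀ x y : ℤ, a * x + b + (a * y + b) - d = a * (x + y) + 2 * b - d := by
    intros; ring
  refine existsIH_of_seq (by omega) ht (fun i => a * interleave m i + b) d ?_ ?_ ?_ ?_ ?_
  · intro i hi
    obtain ⟨h1, h2⟩ := interleave_mem m i hi
    exact_mod_cast (hb _ h1 h2).1
  · intro i hi
    obtain ⟨h1, h2⟩ := interleave_mem m i hi
    exact_mod_cast (hb _ h1 h2).2.1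
  · intro i hi
    rw [hsum, interleave_add_succ]
    exact_mod_cast (hb (i + 1 - m) (by omega) (by omega)).2.2
  · rw [hsum, Nat.add_sub_cancel, interleave_zero_add_last]
    exact_mod_cast (hb (-m) (by omega) (by omega)).2.2
  · intro s hs hs'
    obtain ⟨w, ⟨h1, h2⟩, h⟩ := hcov s hs hs'
    obtain ⟨i, hi, hiw⟩ := exists_interleave_eq m w h1 h2
    rcases h with h | h | h
    · exact .inl ⟨i, hi, by rw [hiw, h]⟩
    · exact .inr (.inl ⟨i, hi, by rw [hiw, h]⟩)
    · right; right
      rcases h1.eq_or_lt with rfl | h1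
      · right
        rw [hsum, Nat.add_sub_cancel, interleave_zero_add_last, h]
      · refine .inl ⟨(w + m - 1).toNat, by omega, ?_⟩
        rw [hsum, interleave_add_succ, show ((w + m - 1).toNat : ℤ) + 1 - m = w by omega, h]

lemma existsIH_self {n : ℕ} (hn : 3 ≤ n) (hodd : n % 2 = 1) : ExistsIH n n 3 := by
  obtain ⟨m, rfl⟩ : ∃ m, n = 2 * m + 1 := ⟨n / 2, by omega⟩
  refine existsIH_of_affine (by omega) (Dvd.intro_left _ rfl) 7 3 4 ?_ ?_
  · intro w h1 h2
    refine ⟨?_, ?_, ?_⟩ <;> push_cast <;> cases abs_cases (7 * w + 3) <;>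
      cases abs_cases (7 * w + 3 - 4) <;> cases abs_cases (7 * w + 6 - 4) <;> omega
  · intro s hs hs'
    have h7 : s % 7 ≠ 0 := by
      intro h
      obtain ⟨k, rfl⟩ := Nat.dvd_of_mod_eq_zero h
      exact hs' ⟨k, by ring⟩
    simp only [abs_eq (Int.natCast_nonneg s)]
    have : s % 7 < 7 := Nat.mod_lt _ (by norm_num)
    interval_cases h : s % 7
    · exact absurd rfl h7
    · exact ⟨-(s / 7 : ℕ), by omega, by omega⟩
    · exact ⟨(s / 7 : ℕ), by omega, by omega⟩
    · exact ⟨(s / 7 : ℕ), by omega, by omega⟩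
    · exact ⟨-(s / 7 : ℕ) - 1, by omega, by omega⟩
    · exact ⟨-(s / 7 : ℕ) - 1, by omega, by omega⟩
    · exact ⟨(s / 7 : ℕ) + 1, by omega, by omega⟩

lemma existsIH_two_mul_self {n : ℕ} (hn : 3 ≤ n) (hodd : n % 2 = 1) : ExistsIH (2 * n) n 3 := by
  obtain ⟨m, rfl⟩ : ∃ m, n = 2 * m + 1 := ⟨n / 2, by omega⟩
  refine existsIH_of_affine (by omega) ⟨3, by ring⟩ 8 2 1 ?_ ?_
  · intro w h1 h2
    refine ⟨?_, ?_, ?_⟩ <;> push_cast <;> cases abs_cases (8 * w + 2) <;>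
      cases abs_cases (8 * w + 2 - 1) <;> cases abs_cases (8 * w + 4 - 1) <;> omega
  · intro s hs hs'
    have h4 : s % 4 ≠ 0 := by
      intro h
      obtain ⟨k, rfl⟩ := Nat.dvd_of_mod_eq_zero h
      exact hs' ⟨k, by ring⟩
    simp only [abs_eq (Int.natCast_nonneg s)]
    have : s % 8 < 8 := Nat.mod_lt _ (by norm_num)
    interval_cases h : s % 8
    · omega
    · exact ⟨(s / 8 : ℕ), by omega, by omega⟩
    · exact ⟨(s / 8 : ℕ), by omega, by omega⟩
    · exact ⟨(s / 8 : ℕ), by omega, by omega⟩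
    · omega
    · exact ⟨-(s / 8 : ℕ) - 1, by omega, by omega⟩
    · exact ⟨-(s / 8 : ℕ) - 1, by omega, by omega⟩
    · exact ⟨-(s / 8 : ℕ) - 1, by omega, by omega⟩

/-! ### Zigzags with a sign change: the small values of `t` -/

/-- The graceful zigzag `n, -1, n - 1, -2, …` with all signs reversed from position `h` on. -/
def zigzag (n h i : ℕ) : ℤ :=
  if i < h then (if i % 2 = 0 then n - (i / 2 : ℕ) else -(i / 2 : ℕ) - 1)
  else (if i % 2 = 0 then (i / 2 : ℕ) - n else (i / 2 : ℕ) + 1)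

/-- A shift by `c` of the sequence `zigzag` makes the two off-diagonals `c ± x`, which cover the
two intervals of length `n` adjacent to `c`; the main diagonal covers `[1, n]`. -/
lemma existsIH_of_zigzag {n t c : ℕ} (hn : 3 ≤ n) (h4 : n % 4 = 3) (ht : t ∣ 6 * n)
    (hc : 2 * (n + c) < 6 * n + t)
    (hS : ∀ s : ℕ, 2 * s ≤ 6 * n + t → ¬ 6 * n + t ∣ t * s →
      0 < s ∧ (s ≤ n ∨ s ≠ c ∧ c ≤ s + n ∧ s ≤ c + n)) :
    ExistsIH t n 3 := by
  obtain ⟨m, rfl⟩ : ∃ m, n = 4 * m + 3 := ⟨n / 4, by omega⟩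
  have hx : ∀ i < 4 * m + 3, |zigzag (4 * m + 3) (2 * m + 2) i| ≤ (4 * m + 3 : ℕ) := by
    intro i hi
    rw [abs_le]; unfold zigzag; split_ifs <;> omega
  have hsum : ∀ x y : ℤ, x + c + (y + c) - 2 * c = x + y := by intros; ring
  refine existsIH_of_seq (by omega) ht (fun i => zigzag (4 * m + 3) (2 * m + 2) i + c) (2 * c)
    ?_ ?_ ?_ ?_ ?_
  · intro i hi
    have := abs_le.1 (hx i hi)
    cases abs_cases (zigzag (4 * m + 3) (2 * m + 2) i + c) <;> omega
  · intro i hi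
    have := abs_le.1 (hx i hi)
    cases abs_cases (zigzag (4 * m + 3) (2 * m + 2) i + c - 2 * c) <;> omega
  · intro i hi
    rw [hsum]
    have : |zigzag (4 * m + 3) (2 * m + 2) i + zigzag (4 * m + 3) (2 * m + 2) (i + 1)| ≤
        (4 * m + 3 : ℕ) := by
      rw [abs_le]; unfold zigzag; split_ifs <;> omega
    omega
  · rw [hsum]
    have : |zigzag (4 * m + 3) (2 * m + 2) 0 + zigzag (4 * m + 3) (2 * m + 2) (4 * m + 3 - 1)| ≤
        (4 * m + 3 : ℕ) := by
      rw [abs_le]; unfold zigzag; split_ifs <;> omega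
    omega
  · intro s hs hs'
    simp only [hsum]
    simp only [abs_eq (Int.natCast_nonneg s)]
    obtain ⟨h0, h | ⟨h1, h2, h3⟩⟩ := hS s hs hs'
    · right; right
      rcases eq_or_ne s (2 * m + 1) with rfl | h'
      · right
        unfold zigzag; split_ifs <;> omega
      left
      rcases h.eq_or_lt with rfl | h
      -- the largest sum occurs where the sign changes
      · exact ⟨2 * m + 1, by omega, by unfold zigzag; split_ifs <;> omega⟩
      · exact ⟨4 * m + 2 - s, by omega, by unfold zigzag; split_ifs <;> omega⟩
    · obtain ⟨i, hi, h⟩ : ∃ i < 4 * m + 3, zigzag (4 * m + 3) (2 * m + 2) i = (s : ℤ) - c ∨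
          zigzag (4 * m + 3) (2 * m + 2) i = c - (s : ℤ) := by
        by_cases hr : (s : ℤ) - c ≤ 2 * m + 1 ∧ (c : ℤ) - s ≤ 2 * m + 1
        · exact ⟨2 * ((s : ℤ) - c).natAbs - 1, by omega, by unfold zigzag; split_ifs <;> omega⟩
        · exact ⟨2 * (4 * m + 3 - ((s : ℤ) - c).natAbs), by omega,
            by unfold zigzag; split_ifs <;> omega⟩
      rcases h with h | h
      · exact .inl ⟨i, hi, by omega⟩
      · exact .inr (.inl ⟨i, hi, by omega⟩)

lemma existsIH_three {n : ℕ} (h4 : n % 4 = 3) : ExistsIH 3 n 3 := by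
  refine existsIH_of_zigzag (c := 2 * n + 1) (by omega) h4 ⟨2 * n, by ring⟩ (by omega) ?_
  intro s hs hs'
  have h1 : s ≠ 0 := by rintro rfl; simp at hs'
  have h2 : s ≠ 2 * n + 1 := by rintro rfl; exact hs' ⟨1, by ring⟩
  omega

lemma existsIH_six {n : ℕ} (h4 : n % 4 = 3) : ExistsIH 6 n 3 := by
  refine existsIH_of_zigzag (c := 2 * n + 2) (by omega) h4 ⟨n, by ring⟩ (by omega) ?_
  intro s hs hs'
  have h1 : s ≠ 0 := by rintro rfl; simp at hs'
  have h2 : s ≠ 2 * n + 2 := by rintro rfl; exact hs' ⟨2, by ring⟩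
  have h3 : s ≠ n + 1 := by rintro rfl; exact hs' ⟨1, by ring⟩
  have h5 : s ≠ 3 * n + 3 := by rintro rfl; exact hs' ⟨3, by ring⟩
  omega

/-- The analogue of `zigzag` on half-odd integers, `n - 1/2, -1/2, n - 3/2, -3/2, …` with the signs
reversed from position `h` on, shifted by `2n + 1/2`. -/
def halfZigzag (n h i : ℕ) : ℤ :=
  if i < h then (if i % 2 = 0 then 3 * n - (i / 2 : ℕ) else 2 * n - (i / 2 : ℕ))
  else (if i % 2 = 0 then n + 1 + (i / 2 : ℕ) else 2 * n + 1 + (i / 2 : ℕ))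

lemma existsIH_one_or_two {n t : ℕ} (hn : 3 ≤ n) (h4 : n % 4 = 1) (ht : t = 1 ∨ t = 2) :
    ExistsIH t n 3 := by
  obtain ⟨m, rfl⟩ : ∃ m, n = 4 * m + 1 := ⟨n / 4, by omega⟩
  have hdvd : t ∣ 6 * (4 * m + 1) := by
    rcases ht with rfl | rfl
    · exact one_dvd _
    · exact ⟨3 * (4 * m + 1), by ring⟩
  refine existsIH_of_seq hn hdvd (halfZigzag (4 * m + 1) (2 * m + 1)) (4 * (4 * m + 1) + 1)
    ?_ ?_ ?_ ?_ ?_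
  · intro i hi
    have : |halfZigzag (4 * m + 1) (2 * m + 1) i| ≤ 3 * (4 * m + 1) := by
      rw [abs_le]; unfold halfZigzag; split_ifs <;> omega
    omega
  · intro i hi
    have : |halfZigzag (4 * m + 1) (2 * m + 1) i - (4 * (4 * m + 1) + 1)| ≤ 3 * (4 * m + 1) := by
      rw [abs_le]; unfold halfZigzag; split_ifs <;> omega
    omega
  · intro i hi
    have : |halfZigzag (4 * m + 1) (2 * m + 1) i + halfZigzag (4 * m + 1) (2 * m + 1) (i + 1) -
        (4 * (4 * m + 1) + 1)| ≤ 3 * (4 * m + 1) := by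
      rw [abs_le]; unfold halfZigzag; split_ifs <;> omega
    omega
  · have : |halfZigzag (4 * m + 1) (2 * m + 1) 0 +
        halfZigzag (4 * m + 1) (2 * m + 1) (4 * m + 1 - 1) - (4 * (4 * m + 1) + 1)| ≤
        3 * (4 * m + 1) := by
      rw [abs_le]; unfold halfZigzag; split_ifs <;> omega
    omega
  · intro s hs hs'
    have h0 : s ≠ 0 := by rintro rfl; simp at hs'
    have h1 : s ≤ 3 * (4 * m + 1) := by
      rcases ht with rfl | rfl
      · omega
      · have : s ≠ 3 * (4 * m + 1) + 1 := by rintro rfl; exact hs' ⟨1, by ring⟩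
        omega
    simp only [abs_eq (Int.natCast_nonneg s)]
    by_cases h : s ≤ 4 * m + 1
    · right; right
      rcases eq_or_ne s (2 * m) with rfl | h'
      · right
        unfold halfZigzag; split_ifs <;> omega
      left
      rcases h.eq_or_lt with rfl | h
      -- the largest sum occurs where the sign changes
      · exact ⟨2 * m, by omega, by unfold halfZigzag; split_ifs <;> omega⟩
      · exact ⟨4 * m - s, by omega, by unfold halfZigzag; split_ifs <;> omega⟩
    · obtain ⟨i, hi, h⟩ : ∃ i < 4 * m + 1, halfZigzag (4 * m + 1) (2 * m + 1) i = s ∨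
          halfZigzag (4 * m + 1) (2 * m + 1) i = 4 * (4 * m + 1) + 1 - s := by
        -- the half-odd label of `s` is `|r| / 2` with `r` as follows
        obtain ⟨r, hr⟩ : ∃ r : ℤ, r = 2 * s - (4 * (4 * m + 1) + 1) := ⟨_, rfl⟩
        by_cases hr' : r.natAbs < 4 * m + 1
        · exact ⟨r.natAbs, by omega, by unfold halfZigzag; split_ifs <;> omega⟩
        · exact ⟨2 * (4 * m + 1) - 1 - r.natAbs, by omega,
            by unfold halfZigzag; split_ifs <;> omega⟩
      rcases h with h | h
      · exact .inl ⟨i, hi, by omega⟩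
      · exact .inr (.inl ⟨i, hi, by omega⟩)

/-! ### The parity obstruction -/

lemma Int.even_sum_iff_even_sum_natAbs {ι : Type*} (s : Finset ι) (f : ι → ℤ) :
    Even (∑ i ∈ s, f i) ↔ Even (∑ i ∈ s, (f i).natAbs) := by
  classical
  induction s using Finset.induction_on with
  | empty => simp
  | insert a s ha ih => rw [Finset.sum_insert ha, Finset.sum_insert ha, Int.even_add,
      Nat.even_add, ih, Int.natAbs_even]

/-- An array has `3n` filled cells. If `f 0, …, f (3n - 1)` are distinct integers in `[0, v / 2]`
whose classes modulo `v` lie outside `J`, then they are the absolute values of the entries, each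
occurring once; as the entries add up to `0`, the sum of their absolute values is even. -/
lemma ExistsIH.even_sum {n t : ℕ} (h : ExistsIH t n 3) (f : ℕ → ℕ)
    (hf : Set.InjOn f (Finset.range (3 * n)))
    (hle : ∀ k < 3 * n, 2 * f k ≤ 6 * n + t) (hdvd : ∀ k < 3 * n, ¬ 6 * n + t ∣ t * f k) :
    Even (∑ k ∈ Finset.range (3 * n), f k) := by
  obtain ⟨J, A, hA⟩ := h
  have : NeZero (2 * n * 3 + t) := ⟨hA.modulus_pos.ne'⟩
  have hv : 2 * n * 3 + t = 6 * n + t := by ring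
  let F : Finset (Fin n × Fin n) := Finset.univ.filter fun p => (A p.1 p.2).isSome
  let g : Fin n × Fin n → ℕ := fun p => (cellInt (A p.1 p.2)).natAbs
  have hF : F.card = 3 * n := by
    have : F.card = ∑ i : Fin n, (Finset.univ.filter fun j : Fin n => (A i j).isSome).card := by
      simp only [F, Finset.card_filter, Fintype.sum_prod_type]
    rw [this, Finset.sum_congr rfl fun i _ => hA.row_filled i]
    simp [mul_comm]
  let S : Finset ℕ := (Finset.range (3 * n)).image f
  have hScard : S.card = 3 * n := by
    rw [Finset.card_image_of_injOn hf, Finset.card_range]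
  have hsub : S ⊆ F.image g := by
    intro s hs
    obtain ⟨k, hk, rfl⟩ := Finset.mem_image.1 hs
    have hk := Finset.mem_range.1 hk
    have hval : ((f k : ℕ) : ZMod (2 * n * 3 + t)).valMinAbs = (f k : ℤ) := by
      have := hle k hk
      refine (ZMod.valMinAbs_spec _ _).2 ⟨by simp, ?_, ?_⟩
      · have := hA.modulus_pos
        omega
      · push_cast; omega
    have hJ : ((f k : ℕ) : ZMod (2 * n * 3 + t)) ∉ J := by
      intro hmem
      have h0 : t • (⟨_, hmem⟩ : J) = 0 := by
        have : Nat.card J • (⟨_, hmem⟩ : J) = 0 := card_nsmul_eq_zero'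
        rwa [hA.card_subgroup] at this
      apply hdvd k hk
      rw [← hv, ← ZMod.natCast_eq_zero_iff]
      simpa [nsmul_eq_mul] using congrArg Subtype.val h0
    rw [Finset.mem_image]
    rcases hA.covers _ hJ with ⟨i, j, hij⟩ | ⟨i, j, hij⟩
    · refine ⟨(i, j), by simp [F, hij], ?_⟩
      simp [g, hij, cellInt, hval]
    · refine ⟨(i, j), by simp [F, hij], ?_⟩
      simp only [g, hij, cellInt, Option.elim_some, ZMod.natAbs_valMinAbs_neg, hval,
        Int.natAbs_natCast]
  have heq : S = F.image g := by
    refine Finset.eq_of_subset_of_card_le hsub ?_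
    rw [hScard, ← hF]
    exact Finset.card_image_le
  have hinj : Set.InjOn g F := by
    rw [← Finset.card_image_iff, ← heq, hScard, hF]
  have hsum : ∑ k ∈ Finset.range (3 * n), f k = ∑ p ∈ F, g p := by
    rw [← Finset.sum_image hf (f := fun s => s), ← Finset.sum_image hinj (f := fun s => s)]
    exact Finset.sum_congr heq fun _ _ => rfl
  have hzero : ∑ p ∈ F, cellInt (A p.1 p.2) = 0 := by
    have : ∑ p ∈ F, cellInt (A p.1 p.2) = ∑ p : Fin n × Fin n, cellInt (A p.1 p.2) := by
      refine Finset.sum_subset (Finset.subset_univ _) fun p _ hp => ?_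
      have : A p.1 p.2 = none := by simpa [F] using hp
      simp [this, cellInt]
    rw [this, Fintype.sum_prod_type]
    exact Finset.sum_eq_zero fun i _ => hA.row_sum_int i
  rw [hsum, ← Int.even_sum_iff_even_sum_natAbs, hzero]
  exact Even.zero

lemma sum_range_succ_mul_two (n : ℕ) : (∑ k ∈ Finset.range n, (k + 1)) * 2 = n * (n + 1) := by
  have := Finset.sum_range_id_mul_two (n + 1)
  rw [Finset.sum_range_succ'] at this
  simpa [mul_comm] using this

lemma not_existsIH_one_or_two {n t : ℕ} (h4 : n % 4 = 3) (ht : t = 1 ∨ t = 2) :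
    ¬ ExistsIH t n 3 := by
  intro h
  have := h.even_sum (fun k => k + 1) (fun a _ b _ h => by simpa using h)
    (fun k hk => by omega) (fun k hk hd => by
      have := Nat.le_of_dvd (by rcases ht with rfl | rfl <;> omega) hd
      rcases ht with rfl | rfl <;> omega)
  obtain ⟨m, rfl⟩ : ∃ m, n = 4 * m + 3 := ⟨n / 4, by omega⟩
  have hs := sum_range_succ_mul_two (3 * (4 * m + 3))
  obtain ⟨c, hc⟩ := this
  rw [hc] at hs
  ring_nf at hs
  omega

lemma sum_range_add_ite (a b : ℕ) :
    ∑ k ∈ Finset.range (a + b), (if k < a then 0 else 1) = b := by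
  induction b with
  | zero => exact Finset.sum_eq_zero fun k hk => if_pos (Finset.mem_range.1 hk)
  | succ b ih => rw [← add_assoc, Finset.sum_range_succ, ih, if_neg (by omega)]

/-- The absolute values of the entries for `t = 3` are `1, …, 3n + 1` without `2n + 1`. -/
lemma not_existsIH_three {n : ℕ} (h4 : n % 4 = 1) : ¬ ExistsIH 3 n 3 := by
  intro h
  have := h.even_sum (fun k => k + 1 + if k < 2 * n then 0 else 1)
    (fun a _ b _ h => by grind)
    (fun k hk => by split_ifs <;> omega) (fun k hk hd => by
      obtain ⟨c, hc⟩ := hd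
      have hc2 : c < 2 := by
        by_contra! h2
        have := Nat.mul_le_mul_left (6 * n + 3) h2
        grind
      interval_cases c <;> grind)
  have h2 := sum_range_add_ite (2 * n) n
  rw [← show 3 * n = 2 * n + n by ring] at h2
  rw [Finset.sum_add_distrib, h2] at this
  have hs := sum_range_succ_mul_two (3 * n)
  obtain ⟨m, rfl⟩ : ∃ m, n = 4 * m + 1 := ⟨n / 4, by omega⟩
  obtain ⟨c, hc⟩ := this
  set T := ∑ k ∈ Finset.range (3 * (4 * m + 1)), (k + 1)
  ring_nf at hs hc
  omega

/-- The absolute values of the entries for `t = 6` are `1, …, 3n + 2` without `n + 1` and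
`2n + 2`. -/
lemma not_existsIH_six {n : ℕ} (h4 : n % 4 = 1) : ¬ ExistsIH 6 n 3 := by
  intro h
  have := h.even_sum
    (fun k => k + 1 + ((if k < n then 0 else 1) + if k < 2 * n then 0 else 1))
    (fun a _ b _ h => by grind)
    (fun k hk => by split_ifs <;> omega) (fun k hk hd => by
      rw [show 6 * n + 6 = 6 * (n + 1) by ring] at hd
      obtain ⟨c, hc⟩ := Nat.dvd_of_mul_dvd_mul_left (by norm_num) hd
      have hc2 : c < 3 := by
        by_contra! h2
        have := Nat.mul_le_mul_left (n + 1) h2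
        grind
      interval_cases c <;> grind)
  have h1 := sum_range_add_ite n (2 * n)
  rw [← show 3 * n = n + 2 * n by ring] at h1
  have h2 := sum_range_add_ite (2 * n) n
  rw [← show 3 * n = 2 * n + n by ring] at h2
  rw [Finset.sum_add_distrib,
    Finset.sum_add_distrib (f := fun k => if k < n then 0 else 1), h1, h2] at this
  have hs := sum_range_succ_mul_two (3 * n)
  obtain ⟨m, rfl⟩ : ∃ m, n = 4 * m + 1 := ⟨n / 4, by omega⟩
  obtain ⟨c, hc⟩ := this
  set T := ∑ k ∈ Finset.range (3 * (4 * m + 1)), (k + 1)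
  ring_nf at hs hc
  omega

/-- The absolute values of the entries for `t = 3n` are the first `3n` integers coprime to `3`. -/
lemma not_existsIH_three_mul {n : ℕ} (hodd : n % 2 = 1) : ¬ ExistsIH (3 * n) n 3 := by
  intro h
  have := h.even_sum (fun k => k + 1 + k / 2)
    (fun a _ b _ h => by grind)
    (fun k hk => by omega) (fun k hk hd => by
      rw [show 6 * n + 3 * n = 3 * n * 3 by ring] at hd
      have := Nat.dvd_of_mul_dvd_mul_left (by omega) hd
      omega)
  have key : ∀ m : ℕ, (∑ k ∈ Finset.range (3 * (2 * m + 1)), (k + 1 + k / 2)) % 2 = 1 := by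
    intro m
    induction m with
    | zero => decide
    | succ m ih =>
      rw [show 3 * (2 * (m + 1) + 1) = 3 * (2 * m + 1) + 1 + 1 + 1 + 1 + 1 + 1 by ring]
      simp only [Finset.sum_range_succ]
      omega
  obtain ⟨m, rfl⟩ : ∃ m, n = 2 * m + 1 := ⟨n / 2, by omega⟩
  have := key m
  grind

/-- The absolute values of the entries for `t = 6n` are the first `3n` odd numbers. -/
lemma not_existsIH_six_mul {n : ℕ} (hodd : n % 2 = 1) : ¬ ExistsIH (6 * n) n 3 := by
  intro h
  have := h.even_sum (fun k => 2 * k + 1)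
    (fun a _ b _ h => by grind)
    (fun k hk => by omega) (fun k hk hd => by
      rw [show 6 * n + 6 * n = 6 * n * 2 by ring] at hd
      have := Nat.dvd_of_mul_dvd_mul_left (by omega) hd
      omega)
  rw [Finset.sum_add_distrib, ← Finset.mul_sum, Finset.sum_const, Finset.card_range] at this
  grind

/-! ### The possible values of `t` -/

lemma eq_or_eq_of_dvd_six_mul_prime {n t : ℕ} (hn : n.Prime) (h : t ∣ 6 * n) :
    t = 1 ∨ t = 2 ∨ t = 3 ∨ t = 6 ∨ t = n ∨ t = 2 * n ∨ t = 3 * n ∨ t = 6 * n := by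
  obtain ⟨a, b, ha, hb, rfl⟩ := exists_dvd_and_dvd_of_dvd_mul h
  have ha6 : a ≤ 6 := Nat.le_of_dvd (by norm_num) ha
  rcases (Nat.dvd_prime hn).1 hb with rfl | rfl
  · interval_cases a <;> simp_all
  · interval_cases a <;> simp_all

theorem mainTheorem1 (n : ℕ) (hprime : n.Prime) (hn : 3 ≤ n) :
    (n ≡ 1 [MOD 4] → ∀ t : ℕ, ExistsIH t n 3 ↔ t ∈ ({1, 2, n, 2 * n} : Set ℕ)) ∧
    (n ≡ 3 [MOD 4] → ∀ t : ℕ, ExistsIH t n 3 ↔ t ∈ ({3, 6, n, 2 * n} : Set ℕ)) := by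
  have hcases : ∀ t, ExistsIH t n 3 →
      t = 1 ∨ t = 2 ∨ t = 3 ∨ t = 6 ∨ t = n ∨ t = 2 * n ∨ t = 3 * n ∨ t = 6 * n := by
    rintro t ⟨J, A, hA⟩
    exact eq_or_eq_of_dvd_six_mul_prime hprime (by
      rw [show 6 * n = 2 * n * 3 by ring]; exact hA.order_dvd)
  simp only [Nat.ModEq, Set.mem_insert_iff, Set.mem_singleton_iff]
  refine ⟨fun h4 t => ⟨fun h => ?_, ?_⟩, fun h4 t => ⟨fun h => ?_, ?_⟩⟩
  · rcases hcases t h with rfl | rfl | rfl | rfl | rfl | rfl | rfl | rfl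
    · simp
    · simp
    · exact absurd h (not_existsIH_three h4)
    · exact absurd h (not_existsIH_six h4)
    · simp
    · simp
    · exact absurd h (not_existsIH_three_mul (by omega))
    · exact absurd h (not_existsIH_six_mul (by omega))
  · rintro (rfl | rfl | rfl | rfl)
    · exact existsIH_one_or_two hn h4 (.inl rfl)
    · exact existsIH_one_or_two hn h4 (.inr rfl)
    · exact existsIH_self hn (by omega)
    · exact existsIH_two_mul_self hn (by omega)
  · rcases hcases t h with rfl | rfl | rfl | rfl | rfl | rfl | rfl | rfl
    · exact absurd h (not_existsIH_one_or_two h4 (.inl rfl))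
    · exact absurd h (not_existsIH_one_or_two h4 (.inr rfl))
    · simp
    · simp
    · simp
    · simp
    · exact absurd h (not_existsIH_three_mul (by omega))
    · exact absurd h (not_existsIH_six_mul (by omega))
  · rintro (rfl | rfl | rfl | rfl)
    · exact existsIH_three h4
    · exact existsIH_six h4
    · exact existsIH_self hn (by omega)
    · exact existsIH_two_mul_self hn (by omega)
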